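/- Let $a>0$, $b\ge 0$, $c\in\mathbb{R}$ and $\beta>\alpha>0$ be real numbers. Let ${}_2F_1(\beta-1,\alpha;\beta;\cdot)$ denote the principal branch of the Gauss hypergeometric function, that is, the analytic continuation of the Gauss series $\sum_{n\ge 0}\frac{(\beta-1)_n(\alpha)_n}{(\beta)_n}\frac{x^n}{n!}$ from $|x|<1$ to $\mathbb{C}\setminus[1,\infty)$, and let $z^{\alpha-1}$ be the principal power. Consider, for $z\in\mathbb{C}\setminus(-\infty,0]$, the equation $$\frac{\Gamma(\alpha)\Gamma(\beta-\alpha)}{a^{\beta-1}\Gamma(\beta)}\,z^{\alpha-1}\,{}_2F_1\!\left(\beta-1,\alpha;\beta;1-\frac{z}{a}\right)-bz-c=0. \qquad (*)$$ For $\alpha>1$ put $M=a^{\alpha-\beta}\,\Gamma(\alpha-1)\,\Gamma(\beta-\alpha)/\Gamma(\beta-1)$. Then $(*)$ has exactly one solution in $\mathbb{C}\setminus(-\infty,0]$ under each of the following conditions: 1. $b>0$, $\alpha>1$ and $c<M$; 2. $b>0$ and $\alpha\le 1$; 3. $b=0$, $\alpha>1$ and $0<c<M$; 4. $b=0$, $\alpha\le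 1$ and $c>0$. This solution $z=x$ is real and positive, and if $b>0$ and $\alpha>1$ it satisfies $0<x<(M-c)/b$. If none of the four conditions holds, $(*)$ has no solution in $\mathbb{C}\setminus(-\infty,0]$. Moreover, ${}_2F_1(\beta-1,\alpha;\beta;1-z/a)\ne 0$ for every $z\in\mathbb{C}\setminus(-\infty,0]$. -/

import Mathlib

noncomputable section

/-- The plane cut along `[1, ∞)`, the standard domain of the principal branch of the Gauss
hypergeometric function. -/
def hypergeometricCutPlane : Set ℂ := {x : ℂ | 1 - x ∈ Complex.slitPlane}

/-- `F` is a (single-valued) analytic continuation to `ℂ \ [1, ∞)` of the Gauss hypergeometric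
series `∑ (p)ₙ (q)ₙ / (r)ₙ xⁿ / n!`, which converges for `‖x‖ < 1` when `r` is not a nonpositive
integer. -/
def IsGaussContinuation (p q r : ℂ) (F : ℂ → ℂ) : Prop :=
  DifferentiableOn ℂ F hypergeometricCutPlane ∧
    ∀ x ∈ Metric.ball (0 : ℂ) 1, F x = ordinaryHypergeometric p q r x

open Classical in
/-- The principal branch of the Gauss hypergeometric function `₂F₁(p, q; r; x)` on
`ℂ \ [1, ∞)`: the analytic continuation of the Gauss series. (Mathlib's `ordinaryHypergeometric`
is the sum of the series only, with a junk value where the series diverges.) The values on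
`[1, ∞)` carry no meaning. -/
def gaussHypergeometric (p q r : ℂ) : ℂ → ℂ :=
  if h : ∃ F : ℂ → ℂ, IsGaussContinuation p q r F then h.choose else 0

theorem isOpen_hypergeometricCutPlane : IsOpen hypergeometricCutPlane :=
  Complex.isOpen_slitPlane.preimage (by fun_prop : Continuous fun x : ℂ => 1 - x)

theorem ball_subset_hypergeometricCutPlane :
    Metric.ball (0 : ℂ) 1 ⊆ hypergeometricCutPlane := by
  intro x hx
  refine Or.inl ?_
  have h1 : ‖x‖ < 1 := by simpa using hx
  have h2 : x.re ≤ ‖x‖ := Complex.re_le_norm x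
  simp only [Complex.sub_re, Complex.one_re]
  linarith

theorem isPreconnected_hypergeometricCutPlane : IsPreconnected hypergeometricCutPlane := by
  have h : hypergeometricCutPlane = (fun x : ℂ => 1 - x) '' Complex.slitPlane := by
    ext x
    constructor
    · intro hx
      exact ⟨1 - x, hx, by ring⟩
    · rintro ⟨y, hy, rfl⟩
      simpa [hypergeometricCutPlane] using hy
  rw [h]
  have hc : IsPreconnected Complex.slitPlane :=
    (Complex.starConvex_one_slitPlane.isPathConnected
      Complex.one_mem_slitPlane).isConnected.isPreconnected
  exact hc.image _ (by fun_prop)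

/-- The continuation is unique, so `gaussHypergeometric` does not depend on the choice made in its
definition. -/
theorem IsGaussContinuation.eqOn {p q r : ℂ} {F : ℂ → ℂ} (hF : IsGaussContinuation p q r F) :
    Set.EqOn (gaussHypergeometric p q r) F hypergeometricCutPlane := by
  have h : ∃ G : ℂ → ℂ, IsGaussContinuation p q r G := ⟨F, hF⟩
  have hdef : gaussHypergeometric p q r = h.choose := dif_pos h
  rw [hdef]
  have hG := h.choose_spec
  have h0 : (0 : ℂ) ∈ Metric.ball (0 : ℂ) 1 := Metric.mem_ball_self one_pos
  refine (hG.1.analyticOnNhd isOpen_hypergeometricCutPlane).eqOn_of_preconnected_of_eventuallyEq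
    (hF.1.analyticOnNhd isOpen_hypergeometricCutPlane) isPreconnected_hypergeometricCutPlane
    (ball_subset_hypergeometricCutPlane h0) ?_
  filter_upwards [Metric.isOpen_ball.mem_nhds h0] with x hx
  rw [hG.2 x hx, hF.2 x hx]

/-- The left-hand side of the transcendental equation
`Γ(α) Γ(β - α) / (a^(β-1) Γ(β)) z^(α-1) ₂F₁(β - 1, α; β; 1 - z/a) - b z - c = 0`,
with the principal branch of `z^(α-1)`. -/
def hypergeometricLHS (a b c α β : ℝ) (z : ℂ) : ℂ :=
  ((Real.Gamma α * Real.Gamma (β - α) / (a ^ (β - 1) * Real.Gamma β) : ℝ) : ℂ) *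
      z ^ ((α : ℂ) - 1) * gaussHypergeometric ((β : ℂ) - 1) α β (1 - z / a) - b * z - c

/-- The critical threshold `a^(α-β) Γ(α-1) Γ(β-α) / Γ(β-1)`, meaningful for `β > α > 1`. -/
def hypergeometricThreshold (a α β : ℝ) : ℝ :=
  a ^ (α - β) * Real.Gamma (α - 1) * Real.Gamma (β - α) / Real.Gamma (β - 1)

/-- The conditions under which the equation is solvable. -/
def HypergeometricSolvable (a b c α β : ℝ) : Prop :=
  (0 < b ∧ 1 < α ∧ c < hypergeometricThreshold a α β) ∨
  (0 < b ∧ α ≤ 1) ∨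
  (b = 0 ∧ 1 < α ∧ 0 < c ∧ c < hypergeometricThreshold a α β) ∨
  (b = 0 ∧ α ≤ 1 ∧ 0 < c)

end

open MeasureTheory Set Filter Topology

/-! Substituting `t = u / (u + w)` in Euler's integral gives, up to the Gamma factor, `₂F₁(β - 1, α;
β; 1 - w) = w ^ (1 - α) S(w)`, where `S` is the Stieltjes transform of a positive weight. With `w =
z / a` the powers of `z` cancel and the equation becomes `a ^ (α - β) S(z / a) = b z + c`.

Positivity of the weight gives `Im S(w)` the sign opposite to `Im w`, while `Im (b z + c) = b Im z`
with `b ≥ 0`; hence every solution is real, and positive because of the cut. On `(0, ∞)` the left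
side strictly decreases to `0`, starting from `M` if `α > 1` and from `+∞` if `α ≤ 1`. Monotonicity
and the intermediate value theorem settle existence and uniqueness, and the left side being below
`M` gives the bound on `x`. Nonvanishing of `₂F₁` is the unsolvable case `b = c = 0`.

The formula with `S` is proved on `(-1, 1)` by termwise integration and carried to the cut plane by
the identity theorem (`isGaussContinuation_stieltjesTransform`). -/

/-! ### Beta integrals. -/

/-- The real Beta integrand is integrable on `(0, 1)`. -/
theorem integrableOn_betaIntegrand {p q : ℝ} (hp : 0 < p) (hq : 0 < q) :
    IntegrableOn (fun t : ℝ => t ^ (p - 1) * (1 - t) ^ (q - 1)) (Ioo 0 1) := by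
  have h := Complex.betaIntegral_convergent (u := p) (v := q) (by simpa) (by simpa)
  rw [intervalIntegrable_iff_integrableOn_Ioo_of_le zero_le_one] at h
  refine h.re.congr ?_
  filter_upwards [ae_restrict_mem measurableSet_Ioo] with t ht
  have h1 : (0 : ℝ) ≤ 1 - t := by linarith [ht.2]
  have : ((t : ℂ) ^ ((p : ℂ) - 1) * (1 - (t : ℂ)) ^ ((q : ℂ) - 1)) =
      ((t ^ (p - 1) * (1 - t) ^ (q - 1) : ℝ) : ℂ) := by
    push_cast [Complex.ofReal_cpow ht.1.le, Complex.ofReal_cpow h1]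
    rfl
  simp only [this]
  exact Complex.ofReal_re _

/-- The real Beta integral in terms of the Gamma function. -/
theorem integral_betaIntegrand {p q : ℝ} (hp : 0 < p) (hq : 0 < q) :
    ∫ t in Ioo (0 : ℝ) 1, t ^ (p - 1) * (1 - t) ^ (q - 1) =
      Real.Gamma p * Real.Gamma q / Real.Gamma (p + q) := by
  have h := Complex.betaIntegral_eq_Gamma_mul_div (p : ℂ) q (by simpa) (by simpa)
  rw [Complex.betaIntegral, intervalIntegral.integral_of_le zero_le_one,
    integral_Ioc_eq_integral_Ioo] at h
  have h2 : ∫ t in Ioo (0 : ℝ) 1, ((t : ℂ) ^ ((p : ℂ) - 1) * (1 - (t : ℂ)) ^ ((q : ℂ) - 1)) =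
      ∫ t in Ioo (0 : ℝ) 1, ((t ^ (p - 1) * (1 - t) ^ (q - 1) : ℝ) : ℂ) := by
    refine setIntegral_congr_fun measurableSet_Ioo fun t ht => ?_
    have h1 : (0 : ℝ) ≤ 1 - t := by linarith [ht.2]
    push_cast [Complex.ofReal_cpow ht.1.le, Complex.ofReal_cpow h1]
    rfl
  rw [h2, integral_complex_ofReal, ← Complex.ofReal_add, Complex.Gamma_ofReal,
    Complex.Gamma_ofReal, Complex.Gamma_ofReal] at h
  exact_mod_cast h

/-! ### From Euler's integral to a Stieltjes transform. -/

theorem image_div_add_Ioi {z : ℝ} (hz : 0 < z) :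
    (fun u : ℝ => u / (u + z)) '' Ioi 0 = Ioo 0 1 := by
  ext t
  constructor
  · rintro ⟨u, hu, rfl⟩
    have hu' : 0 < u := hu
    exact ⟨by positivity, by rw [div_lt_one (by positivity)]; linarith⟩
  · rintro ⟨h0, h1⟩
    have h2 : 0 < 1 - t := by linarith
    refine ⟨z * t / (1 - t), by simp only [mem_Ioi]; positivity, ?_⟩
    simp only
    field_simp
    ring

theorem injOn_div_add_Ioi {z : ℝ} (hz : 0 < z) :
    InjOn (fun u : ℝ => u / (u + z)) (Ioi 0) := by
  intro u hu v hv h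
  have hu' : 0 < u := hu
  have hv' : 0 < v := hv
  simp only at h
  rw [div_eq_div_iff (by positivity) (by positivity)] at h
  have : z * (u - v) = 0 := by linarith
  rcases mul_eq_zero.1 this with h | h <;> linarith

theorem hasDerivWithinAt_div_add {z : ℝ} (hz : 0 < z) {u : ℝ} (hu : u ∈ Ioi (0 : ℝ)) :
    HasDerivWithinAt (fun u : ℝ => u / (u + z)) (z / (u + z) ^ 2) (Ioi 0) u := by
  have hu' : 0 < u := hu
  have h := (hasDerivAt_id u).div ((hasDerivAt_id u).add_const z)
    (by simp only [id]; positivity)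
  refine (h.congr_deriv ?_).hasDerivWithinAt
  simp

/-- The weight `u ^ (α - 1) (1 + u) ^ (1 - β)` of the Stieltjes transform representing the
hypergeometric function. -/
noncomputable def stieltjesWeight (α β u : ℝ) : ℝ := u ^ (α - 1) * (1 + u) ^ (1 - β)

theorem stieltjesWeight_pos (α β : ℝ) {u : ℝ} (hu : 0 < u) : 0 < stieltjesWeight α β u := by
  unfold stieltjesWeight
  positivity

theorem measurable_stieltjesWeight (α β : ℝ) : Measurable (stieltjesWeight α β) := by
  unfold stieltjesWeight
  fun_prop

/-- The Euler integrand under the substitution `t = u / (u + z)`. -/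
theorem eulerIntegrand_div_add (α β : ℝ) {z u : ℝ} (hz : 0 < z) (hu : u ∈ Ioi (0 : ℝ)) :
    |z / (u + z) ^ 2| • ((u / (u + z)) ^ (α - 1) * (1 - u / (u + z)) ^ (β - α - 1) *
      (1 - (1 - z) * (u / (u + z))) ^ (1 - β)) =
      z ^ (1 - α) * (stieltjesWeight α β u / (u + z)) := by
  have hu' : 0 < u := hu
  have hs : 0 < u + z := by positivity
  have h1 : 1 - u / (u + z) = z / (u + z) := by field_simp; ring
  have h2 : 1 - (1 - z) * (u / (u + z)) = z * (1 + u) / (u + z) := by field_simp; ring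
  rw [h1, h2, abs_of_pos (by positivity), smul_eq_mul, stieltjesWeight,
    Real.div_rpow hu'.le hs.le, Real.div_rpow hz.le hs.le,
    Real.div_rpow (by positivity) hs.le, Real.mul_rpow hz.le (by positivity)]
  -- Collecting exponents: those of `z` sum to `1 - α`, and those of `u + z` in `e2` to `1`.
  have e1 : z * z ^ (β - α - 1) * z ^ (1 - β) = z ^ (1 - α) := by
    nth_rewrite 1 [← Real.rpow_one z]
    rw [← Real.rpow_add hz, ← Real.rpow_add hz]
    congr 1; ring
  have e2 : (u + z) ^ 2 * ((u + z) ^ (α - 1) * (u + z) ^ (β - α - 1) * (u + z) ^ (1 - β)) =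
      u + z := by
    rw [← Real.rpow_natCast, ← Real.rpow_add hs, ← Real.rpow_add hs, ← Real.rpow_add hs]
    nth_rewrite 2 [← Real.rpow_one (u + z)]
    congr 1; push_cast; ring
  rw [← e1]
  have e3 : u ^ (α - 1) * (1 + u) ^ (1 - β) / (u + z) = u ^ (α - 1) * (1 + u) ^ (1 - β) /
      ((u + z) ^ 2 * ((u + z) ^ (α - 1) * (u + z) ^ (β - α - 1) * (u + z) ^ (1 - β))) := by
    rw [e2]
  rw [e3]
  generalize u + z = s
  ring

/-- Euler's integral is a Stieltjes transform. -/
theorem integral_eulerIntegrand (α β : ℝ) {z : ℝ} (hz : 0 < z) :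
    ∫ t in Ioo (0 : ℝ) 1, t ^ (α - 1) * (1 - t) ^ (β - α - 1) * (1 - (1 - z) * t) ^ (1 - β) =
      z ^ (1 - α) * ∫ u in Ioi (0 : ℝ), stieltjesWeight α β u / (u + z) := by
  rw [← image_div_add_Ioi hz, integral_image_eq_integral_abs_deriv_smul measurableSet_Ioi
    (fun u hu => hasDerivWithinAt_div_add hz hu) (injOn_div_add_Ioi hz), ← integral_const_mul]
  exact setIntegral_congr_fun measurableSet_Ioi fun u hu => eulerIntegrand_div_add α β hz hu

theorem integrableOn_stieltjesWeight_div_add_one {α β : ℝ} (hα : 0 < α) (hαβ : α < β) :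
    IntegrableOn (fun u => stieltjesWeight α β u / (u + 1)) (Ioi 0) := by
  have h := integrableOn_betaIntegrand hα (sub_pos.2 hαβ)
  rw [← image_div_add_Ioi one_pos, integrableOn_image_iff_integrableOn_abs_deriv_smul
    measurableSet_Ioi (fun u hu => hasDerivWithinAt_div_add one_pos hu)
    (injOn_div_add_Ioi one_pos)] at h
  refine h.congr_fun (fun u hu => ?_) measurableSet_Ioi
  simpa using eulerIntegrand_div_add α β one_pos hu

/-- At `z = 1` the last factor of Euler's integrand is `1`, which leaves a Beta integral. -/
theorem integral_stieltjesWeight_div_add_one {α β : ℝ} (hα : 0 < α) (hαβ : α < β) :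
    ∫ u in Ioi (0 : ℝ), stieltjesWeight α β u / (u + 1) =
      Real.Gamma α * Real.Gamma (β - α) / Real.Gamma β := by
  have h := integral_eulerIntegrand α β one_pos
  have h2 := integral_betaIntegrand hα (sub_pos.2 hαβ)
  simp only [sub_self, zero_mul, sub_zero, Real.one_rpow, mul_one, one_mul] at h
  rw [← h, h2, add_sub_cancel]

/-- Lowering both parameters by one turns the kernel at `z = 0` into the kernel at `z = 1`, so the
limit of the transform at `0` is again a Beta integral when `α > 1`. -/
theorem stieltjesWeight_div_self (α β : ℝ) {u : ℝ} (hu : 0 < u) :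
    stieltjesWeight α β u / u = stieltjesWeight (α - 1) (β - 1) u / (u + 1) := by
  unfold stieltjesWeight
  rw [Real.rpow_sub_one hu.ne' (α - 1), show 1 - (β - 1) = 1 - β + 1 by ring,
    Real.rpow_add_one (by positivity : 1 + u ≠ 0)]
  field_simp
  ring

theorem integrableOn_stieltjesWeight_div_self {α β : ℝ} (hα : 1 < α) (hαβ : α < β) :
    IntegrableOn (fun u => stieltjesWeight α β u / u) (Ioi 0) :=
  (integrableOn_stieltjesWeight_div_add_one (sub_pos.2 hα)
    (sub_lt_sub_right hαβ 1)).congr_fun (fun _ hu => (stieltjesWeight_div_self α β hu).symm)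
    measurableSet_Ioi

theorem integral_stieltjesWeight_div_self {α β : ℝ} (hα : 1 < α) (hαβ : α < β) :
    ∫ u in Ioi (0 : ℝ), stieltjesWeight α β u / u =
      Real.Gamma (α - 1) * Real.Gamma (β - α) / Real.Gamma (β - 1) := by
  rw [setIntegral_congr_fun measurableSet_Ioi fun _ hu => stieltjesWeight_div_self α β hu,
    integral_stieltjesWeight_div_add_one (sub_pos.2 hα) (sub_lt_sub_right hαβ 1)]
  congr 3
  ring

/-! ### The Stieltjes transform on the slit plane. -/

/-- The Stieltjes transform `∫₀^∞ u ^ (α - 1) (1 + u) ^ (1 - β) / (u + z) du`. -/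
noncomputable def stieltjesTransform (α β : ℝ) (z : ℂ) : ℂ :=
  ∫ u in Ioi (0 : ℝ), (stieltjesWeight α β u : ℂ) / (u + z)

/-- Dividing `u + z` by `u + 1` gives a point of the segment from `z` to `1`. The slit plane is
star-convex about `1`, so this compact segment avoids `0`. The bound allows domination by the kernel
at `z = 1`. -/
theorem exists_mul_add_one_le_norm_add {z : ℂ} (hz : z ∈ Complex.slitPlane) :
    ∃ δ > 0, ∀ u : ℝ, 0 ≤ u → δ * (u + 1) ≤ ‖(u : ℂ) + z‖ := by
  have hne : ∀ s ∈ Icc (0 : ℝ) 1, 0 < ‖(s : ℂ) + (1 - s) * z‖ := by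
    intro s hs
    rw [norm_pos_iff]
    have := Complex.starConvex_one_slitPlane hz hs.1 (sub_nonneg.2 hs.2) (by ring)
    refine Complex.slitPlane_ne_zero (?_ : (s : ℂ) + (1 - s) * z ∈ _)
    simpa using this
  obtain ⟨s₀, hs₀, hmin⟩ := isCompact_Icc.exists_isMinOn (nonempty_Icc.2 zero_le_one)
    (by fun_prop : ContinuousOn (fun s : ℝ => ‖(s : ℂ) + (1 - s) * z‖) (Icc 0 1))
  refine ⟨_, hne s₀ hs₀, fun u hu => ?_⟩
  have h1 : (0 : ℝ) < u + 1 := by positivity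
  have hmem : u / (u + 1) ∈ Icc (0 : ℝ) 1 := ⟨by positivity, by rw [div_le_one h1]; linarith⟩
  have h := isMinOn_iff.1 hmin _ hmem
  refine (mul_le_mul_of_nonneg_right h h1.le).trans_eq ?_
  have h1' : (u : ℂ) + 1 ≠ 0 := by exact_mod_cast h1.ne'
  have : (u : ℂ) + z = (((u / (u + 1) : ℝ) : ℂ) + (1 - (u / (u + 1) : ℝ)) * z) *
      ((u + 1 : ℝ) : ℂ) := by
    push_cast
    field_simp
    ring
  rw [this, norm_mul, Complex.norm_real, Real.norm_of_nonneg h1.le]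

theorem ofReal_add_ne_zero {z : ℂ} (hz : z ∈ Complex.slitPlane) {u : ℝ} (hu : 0 ≤ u) :
    (u : ℂ) + z ≠ 0 := by
  obtain ⟨δ, hδ, h⟩ := exists_mul_add_one_le_norm_add hz
  rw [← norm_pos_iff]
  exact lt_of_lt_of_le (by positivity) (h u hu)

theorem integrableOn_stieltjesTransform {α β : ℝ} (hα : 0 < α) (hαβ : α < β) {z : ℂ}
    (hz : z ∈ Complex.slitPlane) :
    IntegrableOn (fun u : ℝ => (stieltjesWeight α β u : ℂ) / (u + z)) (Ioi 0) := by
  obtain ⟨δ, hδ, h⟩ := exists_mul_add_one_le_norm_add hz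
  refine ((integrableOn_stieltjesWeight_div_add_one hα hαβ).const_mul δ⁻¹).mono' ?_ ?_
  · have := measurable_stieltjesWeight α β
    exact Measurable.aestronglyMeasurable (by fun_prop)
  · filter_upwards [ae_restrict_mem measurableSet_Ioi] with u hu
    have hu' : 0 < u := hu
    have hw := stieltjesWeight_pos α β hu'
    rw [norm_div, Complex.norm_real, Real.norm_of_nonneg hw.le]
    calc _ ≤ stieltjesWeight α β u / (δ * (u + 1)) := by
          gcongr
          exact h u hu'.le
      _ = _ := by field_simp

theorem hasDerivAt_stieltjesTransform {α β : ℝ} (hα : 0 < α) (hαβ : α < β) {z : ℂ}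
    (hz : z ∈ Complex.slitPlane) :
    HasDerivAt (stieltjesTransform α β)
      (∫ u in Ioi (0 : ℝ), -(stieltjesWeight α β u : ℂ) / (u + z) ^ 2) z := by
  have hm := measurable_stieltjesWeight α β
  obtain ⟨δ, hδ, h⟩ := exists_mul_add_one_le_norm_add hz
  have hball : ∀ y ∈ Metric.ball z (δ / 2), ∀ u : ℝ, 0 ≤ u → δ / 2 * (u + 1) ≤ ‖(u : ℂ) + y‖ := by
    intro y hy u hu
    have h1 := h u hu
    have h2 : ‖z - y‖ < δ / 2 := by
      rw [Metric.mem_ball, dist_comm, dist_eq_norm] at hy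
      exact hy
    have h3 : ‖(u : ℂ) + z‖ ≤ ‖(u : ℂ) + y‖ + ‖z - y‖ := by
      refine le_trans (le_of_eq ?_) (norm_add_le _ _)
      congr 1; ring
    nlinarith
  refine (hasDerivAt_integral_of_dominated_loc_of_deriv_le
    (F := fun z (u : ℝ) => (stieltjesWeight α β u : ℂ) / (u + z))
    (F' := fun z (u : ℝ) => -(stieltjesWeight α β u : ℂ) / (u + z) ^ 2)
    (bound := fun u => (δ / 2)⁻¹ ^ 2 * (stieltjesWeight α β u / (u + 1)))
    (Metric.ball_mem_nhds z (half_pos hδ)) ?_ (integrableOn_stieltjesTransform hα hαβ hz) ?_ ?_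
    ((integrableOn_stieltjesWeight_div_add_one hα hαβ).const_mul _) ?_).2
  · exact Eventually.of_forall fun y => Measurable.aestronglyMeasurable (by fun_prop)
  · exact Measurable.aestronglyMeasurable (by fun_prop)
  · filter_upwards [ae_restrict_mem measurableSet_Ioi] with u hu y hy
    have hu' : 0 < u := hu
    have hw := stieltjesWeight_pos α β hu'
    have hb := hball y hy u hu'.le
    rw [norm_div, norm_neg, Complex.norm_real, Real.norm_of_nonneg hw.le, norm_pow]
    calc _ ≤ stieltjesWeight α β u / (δ / 2 * (u + 1)) ^ 2 := by gcongr
      _ = (δ / 2)⁻¹ ^ 2 * (stieltjesWeight α β u / (u + 1)) * (u + 1)⁻¹ := by field_simp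
      _ ≤ _ := mul_le_of_le_one_right (by positivity)
          (inv_le_one_of_one_le₀ (by linarith))
  · filter_upwards [ae_restrict_mem measurableSet_Ioi] with u hu y hy
    have hu' : 0 < u := hu
    have hne : (u : ℂ) + y ≠ 0 :=
      norm_pos_iff.1 (lt_of_lt_of_le (by positivity) (hball y hy u hu'.le))
    refine ((hasDerivAt_const y (stieltjesWeight α β u : ℂ)).div
      ((hasDerivAt_id y).const_add (u : ℂ)) hne).congr_deriv ?_
    simp

theorem differentiableOn_stieltjesTransform {α β : ℝ} (hα : 0 < α) (hαβ : α < β) :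
    DifferentiableOn ℂ (stieltjesTransform α β) Complex.slitPlane := fun _ hz =>
  (hasDerivAt_stieltjesTransform hα hαβ hz).differentiableAt.differentiableWithinAt

theorem setIntegral_Ioi_pos {f : ℝ → ℝ} (hf : IntegrableOn f (Ioi 0))
    (hpos : ∀ u, 0 < u → 0 < f u) : 0 < ∫ u in Ioi (0 : ℝ), f u := by
  rw [setIntegral_pos_iff_support_of_nonneg_ae]
  · refine lt_of_lt_of_le ?_ (measure_mono (subset_inter (fun u hu => ?_) Subset.rfl))
    · simp
    · exact (hpos u hu).ne'
  · filter_upwards [ae_restrict_mem measurableSet_Ioi] with u hu using (hpos u hu).le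
  · exact hf

/-- The Stieltjes transform maps the upper half plane to the lower one and vice versa. -/
theorem exists_im_stieltjesTransform {α β : ℝ} (hα : 0 < α) (hαβ : α < β) {z : ℂ}
    (hz : z ∈ Complex.slitPlane) :
    ∃ I > 0, (stieltjesTransform α β z).im = -z.im * I := by
  have hint := integrableOn_stieltjesTransform hα hαβ hz
  -- For real `z` both sides vanish and any `I` serves. The case is separate because integrability
  -- of the kernel below is obtained by dividing by `z.im`.
  by_cases h0 : z.im = 0
  · refine ⟨1, one_pos, ?_⟩
    rw [h0, stieltjesTransform, ← RCLike.im_eq_complex_im, ← integral_im hint]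
    simp [Complex.div_im, h0]
  have key : ∀ u : ℝ, ((stieltjesWeight α β u : ℂ) / (u + z)).im =
      -z.im * (stieltjesWeight α β u / Complex.normSq (u + z)) := by
    intro u
    simp [Complex.div_im]
    ring
  have hI : IntegrableOn (fun u : ℝ => stieltjesWeight α β u / Complex.normSq (u + z))
      (Ioi 0) := by
    have h1 : IntegrableOn (fun u : ℝ => ((stieltjesWeight α β u : ℂ) / (u + z)).im) (Ioi 0) :=
      hint.im
    simp only [key] at h1
    simpa [h0, IntegrableOn] using h1.const_mul (-z.im)⁻¹
  refine ⟨_, setIntegral_Ioi_pos hI fun u hu => div_pos (stieltjesWeight_pos α β hu)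
    (Complex.normSq_pos.2 (ofReal_add_ne_zero hz hu.le)), ?_⟩
  rw [stieltjesTransform, ← RCLike.im_eq_complex_im, ← integral_im hint, ← integral_const_mul]
  exact integral_congr_ae (Eventually.of_forall key)

/-! ### The binomial series and Euler's integral for the Gauss series. -/

theorem Gamma_add_natCast_eq_ascPochhammer_mul {s : ℝ} (hs : 0 < s) (n : ℕ) :
    Real.Gamma (s + n) = (ascPochhammer ℝ n).eval s * Real.Gamma s := by
  induction n with
  | zero => simp
  | succ n ih =>
    rw [Nat.cast_succ, ← add_assoc, Real.Gamma_add_one (by positivity), ih,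
      ascPochhammer_succ_eval]
    ring

theorem neg_one_pow_mul_choose_neg (p : ℝ) (n : ℕ) :
    (-1) ^ n * Ring.choose (-p) n = (ascPochhammer ℝ n).eval p / n.factorial := by
  rw [Ring.choose_eq_smul, Polynomial.descPochhammer_smeval_eq_ascPochhammer,
    Polynomial.ascPochhammer_smeval_cast, Polynomial.ascPochhammer_smeval_eq_eval,
    ← descPochhammer_eval_eq_ascPochhammer, smul_eq_mul]
  have := ascPochhammer_eval_neg_eq_descPochhammer ℝ (-p) n
  rw [neg_neg] at this
  rw [this]
  ring

theorem binomialSeries_neg_apply (p y : ℝ) (n : ℕ) :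
    binomialSeries (𝕂 := ℝ) ℝ (-p) n (fun _ => -y) =
      (ascPochhammer ℝ n).eval p / n.factorial * y ^ n := by
  rw [binomialSeries_apply, ← neg_one_pow_mul_choose_neg]
  simp only [List.ofFn_const, List.prod_replicate, smul_eq_mul]
  rw [neg_pow]
  ring

theorem hasSum_one_sub_rpow_neg (p : ℝ) {y : ℝ} (hy : |y| < 1) :
    HasSum (fun n : ℕ => (ascPochhammer ℝ n).eval p / n.factorial * y ^ n) ((1 - y) ^ (-p)) := by
  have h := (Real.one_add_rpow_hasFPowerSeriesOnBall_zero (a := -p)).hasSum (y := -y) (by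
    simpa [enorm_eq_nnnorm, ← NNReal.coe_lt_coe] using hy)
  simp only [binomialSeries_neg_apply, zero_add] at h
  rw [← sub_eq_add_neg] at h
  exact h

theorem summable_norm_ascPochhammer_div_factorial (p : ℝ) {y : ℝ} (hy : |y| < 1) :
    Summable (fun n : ℕ => ‖(ascPochhammer ℝ n).eval p / n.factorial * y ^ n‖) := by
  have hr := (Real.one_add_rpow_hasFPowerSeriesOnBall_zero (a := -p)).r_le
  have h := (binomialSeries (𝕂 := ℝ) ℝ (-p)).summable_norm_apply (x := -y) (Metric.eball_subset_eball hr (by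
    simpa [enorm_eq_nnnorm, ← NNReal.coe_lt_coe] using hy))
  simpa only [binomialSeries_neg_apply] using h

/-- Termwise integration of Euler's integral. -/
theorem hasSum_eulerIntegral {α β : ℝ} (hα : 0 < α) (hαβ : α < β) (p : ℝ) {x : ℝ} (hx : |x| < 1) :
    HasSum (fun n : ℕ => Real.Gamma α * Real.Gamma (β - α) / Real.Gamma β *
      ((n.factorial : ℝ)⁻¹ * (ascPochhammer ℝ n).eval p * (ascPochhammer ℝ n).eval α *
        ((ascPochhammer ℝ n).eval β)⁻¹ * x ^ n))
      (∫ t in Ioo (0 : ℝ) 1, t ^ (α - 1) * (1 - t) ^ (β - α - 1) * (1 - x * t) ^ (-p)) := by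
  have hβ : 0 < β := hα.trans hαβ
  set c : ℕ → ℝ := fun n => (ascPochhammer ℝ n).eval p / n.factorial with hc
  set F : ℕ → ℝ → ℝ := fun n t =>
    t ^ (α - 1) * (1 - t) ^ (β - α - 1) * (c n * (x * t) ^ n) with hF
  have hFeq : ∀ n, EqOn (fun t => (c n * x ^ n) * (t ^ (α + n - 1) * (1 - t) ^ (β - α - 1)))
      (F n) (Ioo 0 1) := by
    intro n t ht
    simp only [hF]
    rw [show α + n - 1 = α - 1 + n by ring, Real.rpow_add ht.1, Real.rpow_natCast, mul_pow]
    ring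
  have hαn : ∀ n : ℕ, 0 < α + n := fun n => by positivity
  have hint : ∀ n, IntegrableOn (F n) (Ioo 0 1) := fun n =>
    IntegrableOn.congr_fun
      ((integrableOn_betaIntegrand (hαn n) (sub_pos.2 hαβ)).const_mul (c n * x ^ n)) (hFeq n)
      measurableSet_Ioo
  -- Since `0 < t < 1`, the factor `t ^ n` is at most `1`, so the norms are dominated by the
  -- binomial series at `x` times one fixed Beta integral.
  have hsum : Summable fun n => ∫ t in Ioo (0 : ℝ) 1, ‖F n t‖ := by
    refine Summable.of_nonneg_of_le (fun n => integral_nonneg fun t => norm_nonneg _) (fun n => ?_)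
      ((summable_norm_ascPochhammer_div_factorial p hx).mul_right
        (∫ t in Ioo (0 : ℝ) 1, t ^ (α - 1) * (1 - t) ^ (β - α - 1)))
    rw [← integral_const_mul]
    refine setIntegral_mono_on (hint n).norm
      ((integrableOn_betaIntegrand hα (sub_pos.2 hαβ)).const_mul _) measurableSet_Ioo ?_
    intro t ht
    have h1 : 0 ≤ t ^ (α - 1) * (1 - t) ^ (β - α - 1) :=
      mul_nonneg (Real.rpow_nonneg ht.1.le _) (Real.rpow_nonneg (by linarith [ht.2]) _)
    simp only [hF]
    rw [norm_mul, Real.norm_of_nonneg h1, mul_comm, mul_pow, ← mul_assoc (c n), norm_mul (c n * _),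
      Real.norm_of_nonneg (pow_nonneg ht.1.le n)]
    exact mul_le_mul_of_nonneg_right
      (mul_le_of_le_one_right (norm_nonneg _) (pow_le_one₀ ht.1.le ht.2.le)) h1
  have h := hasSum_integral_of_summable_integral_norm hint hsum
  have hR : ∫ t in Ioo (0 : ℝ) 1, ∑' n, F n t =
      ∫ t in Ioo (0 : ℝ) 1, t ^ (α - 1) * (1 - t) ^ (β - α - 1) * (1 - x * t) ^ (-p) := by
    refine setIntegral_congr_fun measurableSet_Ioo fun t ht => ?_
    have hxt : |x * t| < 1 := by
      rw [abs_mul, abs_of_pos ht.1]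
      exact (mul_le_of_le_one_right (abs_nonneg x) ht.2.le).trans_lt hx
    exact ((hasSum_one_sub_rpow_neg p hxt).mul_left _).tsum_eq
  rw [hR] at h
  refine h.congr_fun fun n => ?_
  rw [← setIntegral_congr_fun measurableSet_Ioo (hFeq n), integral_const_mul,
    integral_betaIntegrand (hαn n) (sub_pos.2 hαβ), show α + n + (β - α) = β + n by ring,
    Gamma_add_natCast_eq_ascPochhammer_mul hα, Gamma_add_natCast_eq_ascPochhammer_mul hβ]
  simp only [hc]
  have := (ascPochhammer_pos n β hβ).ne'
  have := (Real.Gamma_pos_of_pos hβ).ne'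
  field_simp

theorem ascPochhammer_eval_ofReal (s : ℝ) (n : ℕ) :
    (ascPochhammer ℂ n).eval (s : ℂ) = ((ascPochhammer ℝ n).eval s : ℝ) := by
  rw [← ascPochhammer_map Complex.ofRealHom, Polynomial.eval_map]
  exact (Polynomial.hom_eval₂ _ (RingHom.id ℝ) Complex.ofRealHom s).symm

/-- **Euler's integral** for the hypergeometric series at a real point. -/
theorem ordinaryHypergeometric_eq_eulerIntegral {α β : ℝ} (hα : 0 < α) (hαβ : α < β) (p : ℝ)
    {x : ℝ} (hx : |x| < 1) :
    ((Real.Gamma α * Real.Gamma (β - α) / Real.Gamma β : ℝ) : ℂ) *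
        ordinaryHypergeometric (p : ℂ) α β (x : ℂ) =
      ((∫ t in Ioo (0 : ℝ) 1,
        t ^ (α - 1) * (1 - t) ^ (β - α - 1) * (1 - x * t) ^ (-p) : ℝ) : ℂ) := by
  rw [← (hasSum_eulerIntegral hα hαβ p hx).tsum_eq, tsum_mul_left, Complex.ofReal_mul,
    Complex.ofReal_tsum, ordinaryHypergeometric_eq_tsum]
  congr 1
  refine tsum_congr fun n => ?_
  simp only [ascPochhammer_eval_ofReal, smul_eq_mul]
  push_cast
  rfl

/-- The radius is `1` unless a parameter is a nonpositive integer; here only `p = 0` can be one, and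
then the series terminates and the radius is infinite. In the application `p = β - 1`. -/
theorem analyticOnNhd_ordinaryHypergeometric {α β p : ℝ} (hα : 0 < α) (hβ : 0 < β) (hp : -1 < p) :
    AnalyticOnNhd ℂ (ordinaryHypergeometric (p : ℂ) α β : ℂ → ℂ) (Metric.ball 0 1) := by
  have hr : 1 ≤ (ordinaryHypergeometricSeries ℂ (p : ℂ) α β).radius := by
    by_cases h0 : p = 0
    · have := ordinaryHypergeometric_radius_top_of_neg_nat₁ (𝕂 := ℂ) ℂ (α : ℂ) β (k := 0)
      simp only [Nat.cast_zero, neg_zero] at this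
      rw [h0, Complex.ofReal_zero, this]
      exact le_top
    · refine (ordinaryHypergeometricSeries_radius_eq_one (𝕂 := ℂ) ℂ (p : ℂ) α β
        fun k => ⟨?_, ?_, ?_⟩).ge
      · intro h
        have h1 : (k : ℝ) = -p := by exact_mod_cast h
        have h2 : (k : ℝ) < 1 := by linarith
        have h3 : k = 0 := by
          have : k < 1 := by exact_mod_cast h2
          omega
        subst h3
        apply h0
        simp at h1
        exact h1
      · intro h
        have h1 : (k : ℝ) = -α := by exact_mod_cast h
        linarith [(Nat.cast_nonneg k : (0 : ℝ) ≤ k)]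
      · intro h
        have h1 : (k : ℝ) = -β := by exact_mod_cast h
        linarith [(Nat.cast_nonneg k : (0 : ℝ) ≤ k)]
  have h := ((ordinaryHypergeometricSeries ℂ (p : ℂ) α β).hasFPowerSeriesOnBall
    (lt_of_lt_of_le one_pos hr)).analyticOnNhd
  refine h.mono fun x hx => Metric.eball_subset_eball hr ?_
  simpa [enorm_eq_nnnorm, ← NNReal.coe_lt_coe] using hx

/-! ### Analytic continuation of the Gauss series. -/

theorem stieltjesTransform_ofReal (α β x : ℝ) :
    stieltjesTransform α β x =
      ((∫ u in Ioi (0 : ℝ), stieltjesWeight α β u / (u + x) : ℝ) : ℂ) := by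
  rw [stieltjesTransform, ← integral_complex_ofReal]
  push_cast
  rfl

/-- Both functions are analytic on the unit disc and agree at its real points by Euler's integral;
these accumulate at `0`, so the identity theorem applies. -/
theorem isGaussContinuation_stieltjesTransform {α β : ℝ} (hα : 0 < α) (hαβ : α < β) :
    IsGaussContinuation ((β : ℂ) - 1) α β fun x =>
      ((Real.Gamma α * Real.Gamma (β - α) / Real.Gamma β : ℝ) : ℂ)⁻¹ *
        ((1 - x) ^ (1 - (α : ℂ)) * stieltjesTransform α β (1 - x)) := by
  have hβ : 0 < β := hα.trans hαβ
  have hB : 0 < Real.Gamma α * Real.Gamma (β - α) / Real.Gamma β :=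
    div_pos (mul_pos (Real.Gamma_pos_of_pos hα) (Real.Gamma_pos_of_pos (sub_pos.2 hαβ)))
      (Real.Gamma_pos_of_pos hβ)
  have hdiff : DifferentiableOn ℂ (fun x : ℂ =>
      ((Real.Gamma α * Real.Gamma (β - α) / Real.Gamma β : ℝ) : ℂ)⁻¹ *
        ((1 - x) ^ (1 - (α : ℂ)) * stieltjesTransform α β (1 - x))) hypergeometricCutPlane := by
    have h1 : DifferentiableOn ℂ (fun x : ℂ => 1 - x) hypergeometricCutPlane := by fun_prop
    exact ((h1.cpow_const fun x hx => hx).mul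
      ((differentiableOn_stieltjesTransform hα hαβ).comp h1 fun x hx => hx)).const_mul _
  refine ⟨hdiff, ?_⟩
  refine AnalyticOnNhd.eqOn_of_preconnected_of_frequently_eq (z₀ := 0)
    ((hdiff.mono ball_subset_hypergeometricCutPlane).analyticOnNhd Metric.isOpen_ball)
    (by exact_mod_cast analyticOnNhd_ordinaryHypergeometric hα hβ (by linarith : -1 < β - 1))
    (convex_ball (0 : ℂ) 1).isPreconnected (Metric.mem_ball_self one_pos) ?_
  have hreal : ∀ x : ℝ, |x| < 1 →
      ((Real.Gamma α * Real.Gamma (β - α) / Real.Gamma β : ℝ) : ℂ)⁻¹ *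
        ((1 - (x : ℂ)) ^ (1 - (α : ℂ)) * stieltjesTransform α β (1 - x)) =
      ordinaryHypergeometric ((β : ℂ) - 1) α β (x : ℂ) := by
    intro x hx
    have hx' : 0 < 1 - x := by linarith [(abs_lt.1 hx).2]
    have h := ordinaryHypergeometric_eq_eulerIntegral hα hαβ (β - 1) hx
    have h2 := integral_eulerIntegrand α β hx'
    rw [sub_sub_cancel] at h2
    rw [neg_sub, h2, Complex.ofReal_mul, ← stieltjesTransform_ofReal,
      Complex.ofReal_cpow hx'.le] at h
    rw [inv_mul_eq_iff_eq_mul₀ (by exact_mod_cast hB.ne')]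
    push_cast at h ⊢
    exact h.symm
  have htend : Tendsto (fun x : ℝ => (x : ℂ)) (𝓝[≠] 0) (𝓝[≠] 0) := by
    refine tendsto_nhdsWithin_iff.2 ⟨?_, ?_⟩
    · exact (Complex.continuous_ofReal.tendsto' 0 0 Complex.ofReal_zero).mono_left
        nhdsWithin_le_nhds
    · filter_upwards [self_mem_nhdsWithin] with x hx
      simpa using hx
  refine htend.frequently (Eventually.frequently ?_)
  have : ∀ᶠ x : ℝ in 𝓝 0, |x| < 1 := by
    filter_upwards [Metric.ball_mem_nhds (0 : ℝ) one_pos] with x hx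
    simpa using hx
  filter_upwards [nhdsWithin_le_nhds this] with x hx using hreal x hx

theorem gaussHypergeometric_eq_stieltjesTransform {α β : ℝ} (hα : 0 < α) (hαβ : α < β) {w : ℂ}
    (hw : w ∈ Complex.slitPlane) :
    gaussHypergeometric ((β : ℂ) - 1) α β (1 - w) =
      ((Real.Gamma α * Real.Gamma (β - α) / Real.Gamma β : ℝ) : ℂ)⁻¹ *
        (w ^ (1 - (α : ℂ)) * stieltjesTransform α β w) := by
  rw [(isGaussContinuation_stieltjesTransform hα hαβ).eqOn (x := 1 - w)
    (by simpa [hypergeometricCutPlane] using hw)]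
  simp

/-! ### The Stieltjes transform on the positive axis: monotonicity and limits. -/

/-- The Stieltjes transform at a real point, as a real number. -/
noncomputable def stieltjesTransformReal (α β x : ℝ) : ℝ :=
  ∫ u in Ioi (0 : ℝ), stieltjesWeight α β u / (u + x)

theorem integrableOn_stieltjesTransformReal {α β : ℝ} (hα : 0 < α) (hαβ : α < β) {x : ℝ}
    (hx : 0 < x) : IntegrableOn (fun u : ℝ => stieltjesWeight α β u / (u + x)) (Ioi 0) := by
  have h := (integrableOn_stieltjesTransform hα hαβ (Complex.ofReal_mem_slitPlane.2 hx)).re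
  simp only [← Complex.ofReal_add, ← Complex.ofReal_div] at h
  exact h

theorem stieltjesTransformReal_pos {α β : ℝ} (hα : 0 < α) (hαβ : α < β) {x : ℝ}
    (hx : 0 < x) : 0 < stieltjesTransformReal α β x :=
  setIntegral_Ioi_pos (integrableOn_stieltjesTransformReal hα hαβ hx) fun _ hu =>
    div_pos (stieltjesWeight_pos α β hu) (add_pos hu hx)

theorem strictAntiOn_stieltjesTransformReal {α β : ℝ} (hα : 0 < α) (hαβ : α < β) :
    StrictAntiOn (stieltjesTransformReal α β) (Ioi 0) := by
  intro x hx y hy hxy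
  have hx' : 0 < x := hx
  have h1 := integrableOn_stieltjesTransformReal hα hαβ hx
  have h2 := integrableOn_stieltjesTransformReal hα hαβ hy
  rw [← sub_pos, stieltjesTransformReal, stieltjesTransformReal, ← integral_sub h1 h2]
  refine setIntegral_Ioi_pos (h1.sub h2) fun u hu => sub_pos.2 ?_
  have := stieltjesWeight_pos α β hu
  gcongr

theorem stieltjesTransformReal_lt {α β : ℝ} (hα : 1 < α) (hαβ : α < β) {x : ℝ} (hx : 0 < x) :
    stieltjesTransformReal α β x <
      Real.Gamma (α - 1) * Real.Gamma (β - α) / Real.Gamma (β - 1) := by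
  have h1 := integrableOn_stieltjesWeight_div_self hα hαβ
  have h2 := integrableOn_stieltjesTransformReal (one_pos.trans hα) hαβ hx
  rw [← integral_stieltjesWeight_div_self hα hαβ, ← sub_pos, stieltjesTransformReal,
    ← integral_sub h1 h2]
  refine setIntegral_Ioi_pos (h1.sub h2) fun u hu => sub_pos.2 ?_
  have := stieltjesWeight_pos α β hu
  gcongr
  linarith

theorem continuousOn_stieltjesTransformReal {α β : ℝ} (hα : 0 < α) (hαβ : α < β) :
    ContinuousOn (stieltjesTransformReal α β) (Ioi 0) := by
  have h : ContinuousOn (fun x : ℝ => (stieltjesTransform α β x).re) (Ioi 0) :=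
    Complex.continuous_re.comp_continuousOn
      ((differentiableOn_stieltjesTransform hα hαβ).continuousOn.comp
        Complex.continuous_ofReal.continuousOn fun x hx => Complex.ofReal_mem_slitPlane.2 hx)
  refine h.congr fun x _ => ?_
  simp only [stieltjesTransform_ofReal, Complex.ofReal_re]
  rfl

theorem tendsto_stieltjesTransformReal_atTop {α β : ℝ} (hα : 0 < α) (hαβ : α < β) :
    Tendsto (stieltjesTransformReal α β) atTop (𝓝 0) := by
  have hm := measurable_stieltjesWeight α β
  have h := tendsto_integral_filter_of_dominated_convergence
    (μ := volume.restrict (Ioi 0)) (l := atTop)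
    (F := fun x u : ℝ => stieltjesWeight α β u / (u + x)) (f := fun _ => (0 : ℝ))
    (fun u => stieltjesWeight α β u / (u + 1)) ?_ ?_
    (integrableOn_stieltjesTransformReal hα hαβ one_pos) ?_
  · simp only [integral_zero] at h
    exact h
  · exact Eventually.of_forall fun x => Measurable.aestronglyMeasurable (by fun_prop)
  · filter_upwards [eventually_ge_atTop 1] with x hx
    filter_upwards [ae_restrict_mem measurableSet_Ioi] with u hu
    have hu' : 0 < u := hu
    have := stieltjesWeight_pos α β hu
    rw [Real.norm_of_nonneg (by positivity)]
    gcongr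
  · exact Eventually.of_forall fun u =>
      tendsto_const_nhds.div_atTop (tendsto_atTop_add_const_left _ _ tendsto_id)

theorem tendsto_stieltjesTransformReal_zero {α β : ℝ} (hα : 1 < α) (hαβ : α < β) :
    Tendsto (stieltjesTransformReal α β) (𝓝[>] 0)
      (𝓝 (Real.Gamma (α - 1) * Real.Gamma (β - α) / Real.Gamma (β - 1))) := by
  have hm := measurable_stieltjesWeight α β
  rw [← integral_stieltjesWeight_div_self hα hαβ]
  refine tendsto_integral_filter_of_dominated_convergence
    (fun u => stieltjesWeight α β u / u) ?_ ?_
    (integrableOn_stieltjesWeight_div_self hα hαβ) ?_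
  · exact Eventually.of_forall fun x => Measurable.aestronglyMeasurable (by fun_prop)
  · filter_upwards [self_mem_nhdsWithin] with x hx
    filter_upwards [ae_restrict_mem measurableSet_Ioi] with u hu
    have hu' : 0 < u := hu
    have hx' : 0 < x := hx
    have := stieltjesWeight_pos α β hu
    rw [Real.norm_of_nonneg (by positivity)]
    gcongr
    linarith
  · filter_upwards [ae_restrict_mem measurableSet_Ioi] with u hu
    have hu' : u ≠ 0 := (show 0 < u from hu).ne'
    have : ContinuousAt (fun x : ℝ => stieltjesWeight α β u / (u + x)) 0 := by
      refine ContinuousAt.div₀ (by fun_prop) (by fun_prop) (by simpa using hu')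
    have := this.tendsto
    rw [add_zero] at this
    exact this.mono_left nhdsWithin_le_nhds

/-- For `α ≤ 1` the weight is at least `2 ^ (-β)` on `(0, 1]`, and the integral of `1 / (u + x)`
there diverges logarithmically as `x → 0`. -/
theorem log_le_stieltjesTransformReal {α β : ℝ} (hα : 0 < α) (hα1 : α ≤ 1) (hαβ : α < β) {x : ℝ}
    (hx : 0 < x) : 2 ^ (-β) * -Real.log x ≤ stieltjesTransformReal α β x := by
  have hβ : 0 < β := hα.trans hαβ
  have hK : (0 : ℝ) < 2 ^ (-β) := by positivity
  have h1 : ∫ u in (0 : ℝ)..1, (u + x)⁻¹ = Real.log ((1 + x) / x) := by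
    rw [intervalIntegral.integral_comp_add_right (fun u => u⁻¹), zero_add,
      integral_inv_of_pos hx (by positivity)]
  have hint := integrableOn_stieltjesTransformReal hα hαβ hx
  have hinv : IntegrableOn (fun u : ℝ => (u + x)⁻¹) (Ioc 0 1) := by
    refine (ContinuousOn.integrableOn_Icc ?_).mono_set Ioc_subset_Icc_self
    exact ContinuousOn.inv₀ (by fun_prop) fun u hu => (by linarith [hu.1] : 0 < u + x).ne'
  calc 2 ^ (-β) * -Real.log x ≤ 2 ^ (-β) * Real.log ((1 + x) / x) := by
        rw [← Real.log_inv, inv_eq_one_div]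
        gcongr
        linarith
    _ = ∫ u in Ioc (0 : ℝ) 1, 2 ^ (-β) * (u + x)⁻¹ := by
        rw [integral_const_mul, ← intervalIntegral.integral_of_le zero_le_one, h1]
    _ ≤ ∫ u in Ioc (0 : ℝ) 1, stieltjesWeight α β u / (u + x) := by
        refine setIntegral_mono_on (hinv.const_mul _) (hint.mono_set Ioc_subset_Ioi_self)
          measurableSet_Ioc fun u hu => ?_
        have hu0 : 0 < u := hu.1
        rw [div_eq_mul_inv]
        gcongr
        have e1 : (1 : ℝ) ≤ u ^ (α - 1) :=
          Real.one_le_rpow_of_pos_of_le_one_of_nonpos hu0 hu.2 (by linarith)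
        -- The exponent `-β` replaces `1 - β`, whose sign is not known.
        have e2 : (2 : ℝ) ^ (-β) ≤ (1 + u) ^ (-β) :=
          Real.rpow_le_rpow_of_nonpos (by linarith) (by linarith [hu.2]) (by linarith)
        have e3 : (1 + u) ^ (-β) ≤ (1 + u) ^ (1 - β) :=
          Real.rpow_le_rpow_of_exponent_le (by linarith) (by linarith)
        exact (e2.trans e3).trans (le_mul_of_one_le_left (by positivity) e1)
    _ ≤ _ := by
        refine setIntegral_mono_set hint ?_ (Ioc_subset_Ioi_self.eventuallyLE)
        filter_upwards [ae_restrict_mem measurableSet_Ioi] with u hu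
        have hu' : 0 < u := hu
        exact div_nonneg (stieltjesWeight_pos α β hu).le (by positivity)

theorem tendsto_stieltjesTransformReal_zero_atTop {α β : ℝ} (hα : 0 < α) (hα1 : α ≤ 1)
    (hαβ : α < β) : Tendsto (stieltjesTransformReal α β) (𝓝[>] 0) atTop := by
  refine tendsto_atTop_mono' _ ?_ ((tendsto_neg_atBot_atTop.comp
    Real.tendsto_log_nhdsGT_zero).const_mul_atTop (by positivity : (0 : ℝ) < 2 ^ (-β)))
  filter_upwards [self_mem_nhdsWithin] with x hx
  exact log_le_stieltjesTransformReal hα hα1 hαβ hx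

/-! ### The equation in Stieltjes form and its solutions. -/

theorem div_ofReal_mem_slitPlane {a : ℝ} (ha : 0 < a) {z : ℂ} (hz : z ∈ Complex.slitPlane) :
    z / a ∈ Complex.slitPlane := by
  rw [Complex.mem_slitPlane_iff] at hz ⊢
  rw [Complex.div_ofReal_re, Complex.div_ofReal_im]
  exact hz.imp (fun h => div_pos h ha) fun h => div_ne_zero h ha.ne'

theorem hypergeometricLHS_eq_stieltjesTransform {a α β : ℝ} (b c : ℝ) (ha : 0 < a) (hα : 0 < α)
    (hαβ : α < β) {z : ℂ} (hz : z ∈ Complex.slitPlane) :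
    hypergeometricLHS a b c α β z =
      ((a ^ (α - β) : ℝ) : ℂ) * stieltjesTransform α β (z / a) - b * z - c := by
  have hβ : 0 < β := hα.trans hαβ
  have hw := div_ofReal_mem_slitPlane ha hz
  have hw0 : z / (a : ℂ) ≠ 0 := Complex.slitPlane_ne_zero hw
  have ha' : (a : ℂ) ≠ 0 := by exact_mod_cast ha.ne'
  have hpow : z ^ ((α : ℂ) - 1) * (z / a) ^ (1 - (α : ℂ)) = ((a ^ (α - 1) : ℝ) : ℂ) := by
    -- As `a > 0`, the principal logarithms satisfy `log z = log a + log (z / a)` without a branch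
    -- correction.
    have h1 : z ^ ((α : ℂ) - 1) = (a : ℂ) ^ ((α : ℂ) - 1) * (z / a) ^ ((α : ℂ) - 1) := by
      rw [Complex.cpow_def_of_ne_zero (Complex.slitPlane_ne_zero hz),
        Complex.cpow_def_of_ne_zero ha', Complex.cpow_def_of_ne_zero hw0, ← Complex.exp_add,
        ← add_mul, ← Complex.ofReal_log ha.le, ← Complex.log_ofReal_mul ha hw0,
        mul_div_cancel₀ _ ha']
    rw [h1, mul_assoc, ← Complex.cpow_add _ _ hw0, Complex.ofReal_cpow ha.le]
    simp
  rw [hypergeometricLHS, gaussHypergeometric_eq_stieltjesTransform hα hαβ hw]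
  congr 2
  have hG1 : (Real.Gamma α : ℂ) ≠ 0 := by exact_mod_cast (Real.Gamma_pos_of_pos hα).ne'
  have hG2 : (Real.Gamma (β - α) : ℂ) ≠ 0 := by
    exact_mod_cast (Real.Gamma_pos_of_pos (sub_pos.2 hαβ)).ne'
  have hG3 : (Real.Gamma β : ℂ) ≠ 0 := by exact_mod_cast (Real.Gamma_pos_of_pos hβ).ne'
  have ha1 : ((a ^ (β - 1) : ℝ) : ℂ) ≠ 0 := by
    exact_mod_cast (Real.rpow_pos_of_pos ha _).ne'
  have hsplit : a ^ (α - β) = a ^ (α - 1) / a ^ (β - 1) := by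
    rw [← Real.rpow_sub ha]
    congr 1; ring
  rw [hsplit]
  simp only [Complex.ofReal_div, Complex.ofReal_mul]
  rw [← hpow]
  generalize ((a ^ (β - 1) : ℝ) : ℂ) = A at *
  generalize z ^ ((α : ℂ) - 1) = Z
  generalize (z / a) ^ (1 - (α : ℂ)) = W
  field_simp

/-- The left-hand side of the equation on the positive real axis. -/
noncomputable def stieltjesEquationReal (a b c α β x : ℝ) : ℝ :=
  a ^ (α - β) * stieltjesTransformReal α β (x / a) - b * x - c

theorem hypergeometricLHS_ofReal {a α β : ℝ} (b c : ℝ) (ha : 0 < a) (hα : 0 < α)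
    (hαβ : α < β) {x : ℝ} (hx : 0 < x) :
    hypergeometricLHS a b c α β x = (stieltjesEquationReal a b c α β x : ℂ) := by
  rw [hypergeometricLHS_eq_stieltjesTransform b c ha hα hαβ (Complex.ofReal_mem_slitPlane.2 hx),
    ← Complex.ofReal_div, stieltjesTransform_ofReal, stieltjesEquationReal,
    stieltjesTransformReal]
  push_cast
  rfl

theorem eq_ofReal_of_im_eq_zero {z : ℂ} (hz : z ∈ Complex.slitPlane) (h : z.im = 0) :
    ∃ x : ℝ, 0 < x ∧ z = x := by
  refine ⟨z.re, ?_, Complex.ext (by simp) (by simpa using h)⟩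
  rcases Complex.mem_slitPlane_iff.1 hz with h' | h'
  · exact h'
  · exact absurd h h'

/-- The imaginary part of the equation is `-z.im` times a strictly positive quantity, which forces
`z` to be real. -/
theorem eq_ofReal_of_hypergeometricLHS_eq_zero {a b c α β : ℝ} (ha : 0 < a) (hb : 0 ≤ b)
    (hα : 0 < α) (hαβ : α < β) {z : ℂ} (hz : z ∈ Complex.slitPlane)
    (h : hypergeometricLHS a b c α β z = 0) :
    ∃ x : ℝ, 0 < x ∧ z = x ∧ stieltjesEquationReal a b c α β x = 0 := by
  obtain ⟨I, hI, him⟩ := exists_im_stieltjesTransform hα hαβ (div_ofReal_mem_slitPlane ha hz)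
  have h1 := congrArg Complex.im h
  rw [hypergeometricLHS_eq_stieltjesTransform b c ha hα hαβ hz, Complex.sub_im, Complex.sub_im,
    Complex.im_ofReal_mul, Complex.im_ofReal_mul, him, Complex.div_ofReal_im, Complex.ofReal_im,
    Complex.zero_im] at h1
  have hκ : 0 < a ^ (α - β) := Real.rpow_pos_of_pos ha _
  have h2 : z.im * (a ^ (α - β) * I / a + b) = 0 := by
    linear_combination -h1
  have h3 : 0 < a ^ (α - β) * I / a + b := by positivity
  obtain ⟨x, hx, rfl⟩ := eq_ofReal_of_im_eq_zero hz ((mul_eq_zero.1 h2).resolve_right h3.ne')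
  refine ⟨x, hx, rfl, ?_⟩
  rw [hypergeometricLHS_ofReal b c ha hα hαβ hx] at h
  exact_mod_cast h

theorem strictAntiOn_stieltjesEquationReal {a b α β : ℝ} (c : ℝ) (ha : 0 < a) (hb : 0 ≤ b)
    (hα : 0 < α) (hαβ : α < β) : StrictAntiOn (stieltjesEquationReal a b c α β) (Ioi 0) := by
  intro x hx y hy hxy
  have hκ : 0 < a ^ (α - β) := Real.rpow_pos_of_pos ha _
  have h1 := strictAntiOn_stieltjesTransformReal hα hαβ (div_pos hx ha) (div_pos hy ha)
    (div_lt_div_of_pos_right hxy ha)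
  have h2 := mul_lt_mul_of_pos_left h1 hκ
  have h3 := mul_le_mul_of_nonneg_left hxy.le hb
  simp only [stieltjesEquationReal]
  linarith

theorem hypergeometricThreshold_eq (a α β : ℝ) :
    hypergeometricThreshold a α β = a ^ (α - β) *
      (Real.Gamma (α - 1) * Real.Gamma (β - α) / Real.Gamma (β - 1)) := by
  rw [hypergeometricThreshold]
  ring

theorem rpow_mul_stieltjesTransformReal_lt_threshold {a α β : ℝ} (ha : 0 < a) (hα : 1 < α)
    (hαβ : α < β) {x : ℝ} (hx : 0 < x) :
    a ^ (α - β) * stieltjesTransformReal α β (x / a) < hypergeometricThreshold a α β := by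
  rw [hypergeometricThreshold_eq]
  exact mul_lt_mul_of_pos_left (stieltjesTransformReal_lt hα hαβ (div_pos hx ha))
    (Real.rpow_pos_of_pos ha _)

theorem exists_stieltjesEquationReal_neg {a b c α β : ℝ} (ha : 0 < a) (hα : 0 < α) (hαβ : α < β)
    (hbc : 0 < b ∨ b = 0 ∧ 0 < c) : ∃ x, 0 < x ∧ stieltjesEquationReal a b c α β x < 0 := by
  have ht : Tendsto (fun x => a ^ (α - β) * stieltjesTransformReal α β (x / a)) atTop (𝓝 0) := by
    simpa using ((tendsto_stieltjesTransformReal_atTop hα hαβ).comp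
      (tendsto_id.atTop_div_const ha)).const_mul (a ^ (α - β))
  suffices h : ∀ᶠ x in atTop, a ^ (α - β) * stieltjesTransformReal α β (x / a) < b * x + c by
    obtain ⟨x, hx0, hx⟩ := ((eventually_gt_atTop 0).and h).exists
    refine ⟨x, hx0, ?_⟩
    rw [stieltjesEquationReal]
    linarith
  rcases hbc with hb | ⟨rfl, hc⟩
  · have h2 : Tendsto (fun x => b * x + c) atTop atTop :=
      tendsto_atTop_add_const_right _ _ (tendsto_id.const_mul_atTop hb)
    filter_upwards [ht.eventually_lt_const one_pos, h2.eventually_ge_atTop 1] with x h h'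
    exact h.trans_le h'
  · simpa using ht.eventually_lt_const hc

theorem exists_stieltjesEquationReal_pos {a b c α β : ℝ} (ha : 0 < a) (hα : 0 < α) (hαβ : α < β)
    (hc : 1 < α → c < hypergeometricThreshold a α β) :
    ∃ x, 0 < x ∧ 0 < stieltjesEquationReal a b c α β x := by
  have hκ : 0 < a ^ (α - β) := Real.rpow_pos_of_pos ha _
  have hdiv : Tendsto (fun x : ℝ => x / a) (𝓝[>] 0) (𝓝[>] 0) := by
    refine tendsto_nhdsWithin_iff.2 ⟨?_, ?_⟩
    · exact ((continuous_id.div_const a).tendsto' 0 0 (by simp)).mono_left nhdsWithin_le_nhds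
    · filter_upwards [self_mem_nhdsWithin] with x hx using div_pos hx ha
  -- The level `m` separates `c` from the limit of the transform term at `0`: `m` lies below the
  -- threshold if `α > 1`, and any level above `c` works when that limit is infinite.
  obtain ⟨m, hcm, hm⟩ : ∃ m, c < m ∧
      ∀ᶠ x in 𝓝[>] 0, m < a ^ (α - β) * stieltjesTransformReal α β (x / a) := by
    rcases lt_or_ge 1 α with h1 | h1
    · obtain ⟨m, hcm, hm⟩ := exists_between (hc h1)
      rw [hypergeometricThreshold_eq] at hm
      exact ⟨m, hcm, (((tendsto_stieltjesTransformReal_zero h1 hαβ).comp hdiv).const_mul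
        (a ^ (α - β))).eventually_const_lt hm⟩
    · exact ⟨c + 1, by linarith, (((tendsto_stieltjesTransformReal_zero_atTop hα h1 hαβ).comp
        hdiv).const_mul_atTop hκ).eventually_gt_atTop _⟩
  have hlin : Tendsto (fun x : ℝ => b * x + c) (𝓝[>] 0) (𝓝 c) :=
    ((by fun_prop : Continuous fun x : ℝ => b * x + c).tendsto' 0 c (by simp)).mono_left
      nhdsWithin_le_nhds
  obtain ⟨x, hx0, hx, hx'⟩ := ((eventually_mem_nhdsWithin (a := (0 : ℝ)) (s := Ioi 0)).and
    (hm.and (hlin.eventually_lt_const hcm))).exists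
  refine ⟨x, hx0, ?_⟩
  rw [stieltjesEquationReal]
  linarith

theorem exists_stieltjesEquationReal_eq_zero {a b c α β : ℝ} (ha : 0 < a) (hb : 0 ≤ b)
    (hα : 0 < α) (hαβ : α < β) (hbc : 0 < b ∨ b = 0 ∧ 0 < c)
    (hc : 1 < α → c < hypergeometricThreshold a α β) :
    ∃ x, 0 < x ∧ stieltjesEquationReal a b c α β x = 0 := by
  obtain ⟨p, hp, hp'⟩ := exists_stieltjesEquationReal_pos (b := b) ha hα hαβ hc
  obtain ⟨q, hq, hq'⟩ := exists_stieltjesEquationReal_neg ha hα hαβ hbc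
  have hpq : p < q :=
    ((strictAntiOn_stieltjesEquationReal c ha hb hα hαβ).lt_iff_gt hq hp).1 (hq'.trans hp')
  have hcont : ContinuousOn (stieltjesEquationReal a b c α β) (Icc p q) := by
    have h1 : ContinuousOn (fun x => stieltjesTransformReal α β (x / a)) (Icc p q) :=
      (continuousOn_stieltjesTransformReal hα hαβ).comp (by fun_prop)
        fun x hx => div_pos (hp.trans_le hx.1) ha
    unfold stieltjesEquationReal
    fun_prop
  obtain ⟨x, hx, h0⟩ := intermediate_value_Icc' hpq.le hcont ⟨hq'.le, hp'.le⟩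
  exact ⟨x, hp.trans_le hx.1, h0⟩

theorem hypergeometricLHS_ne_zero_of_not_solvable {a b c α β : ℝ} (ha : 0 < a) (hb : 0 ≤ b)
    (hα : 0 < α) (hαβ : α < β) (hns : ¬ HypergeometricSolvable a b c α β) {z : ℂ}
    (hz : z ∈ Complex.slitPlane) : hypergeometricLHS a b c α β z ≠ 0 := by
  intro h
  obtain ⟨x, hx, -, h0⟩ := eq_ofReal_of_hypergeometricLHS_eq_zero ha hb hα hαβ hz h
  rw [stieltjesEquationReal] at h0
  have hpos := mul_pos (Real.rpow_pos_of_pos ha (α - β))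
    (stieltjesTransformReal_pos hα hαβ (div_pos hx ha))
  have hbx : 0 ≤ b * x := by positivity
  have hlt : 1 < α → c < hypergeometricThreshold a α β := fun h1 => by
    linarith [rpow_mul_stieltjesTransformReal_lt_threshold ha h1 hαβ hx]
  apply hns
  rcases hb.lt_or_eq with hb' | rfl
  · rcases lt_or_ge 1 α with h1 | h1
    · exact Or.inl ⟨hb', h1, hlt h1⟩
    · exact Or.inr (Or.inl ⟨hb', h1⟩)
  · have hc : 0 < c := by linarith
    rcases lt_or_ge 1 α with h1 | h1
    · exact Or.inr (Or.inr (Or.inl ⟨rfl, h1, hc, hlt h1⟩))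
    · exact Or.inr (Or.inr (Or.inr ⟨rfl, h1, hc⟩))

/-- A zero of the hypergeometric factor would solve the equation with `b = c = 0`, which meets none
of the solvability conditions. -/
theorem gaussHypergeometric_ne_zero {a α β : ℝ} (ha : 0 < a) (hα : 0 < α) (hαβ : α < β) {z : ℂ}
    (hz : z ∈ Complex.slitPlane) : gaussHypergeometric ((β : ℂ) - 1) α β (1 - z / a) ≠ 0 := by
  intro h
  have hns : ¬ HypergeometricSolvable a 0 0 α β := by simp [HypergeometricSolvable]
  refine hypergeometricLHS_ne_zero_of_not_solvable ha le_rfl hα hαβ hns hz ?_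
  simp [hypergeometricLHS, h]

theorem mainTheorem12 (a b c α β : ℝ) (ha : 0 < a) (hb : 0 ≤ b) (hα : 0 < α) (hαβ : α < β) :
    (HypergeometricSolvable a b c α β →
      ∃ x : ℝ, 0 < x ∧
        (∀ z ∈ Complex.slitPlane, hypergeometricLHS a b c α β z = 0 ↔ z = (x : ℂ)) ∧
        (0 < b → 1 < α → x < (hypergeometricThreshold a α β - c) / b)) ∧
    (¬ HypergeometricSolvable a b c α β →
      ∀ z ∈ Complex.slitPlane, hypergeometricLHS a b c α β z ≠ 0) ∧
    (∀ z ∈ Complex.slitPlane, gaussHypergeometric ((β : ℂ) - 1) α β (1 - z / a) ≠ 0) := by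
  refine ⟨fun hs => ?_, fun hns z hz =>
    hypergeometricLHS_ne_zero_of_not_solvable ha hb hα hαβ hns hz,
    fun z hz => gaussHypergeometric_ne_zero ha hα hαβ hz⟩
  have hcond : (0 < b ∨ b = 0 ∧ 0 < c) ∧ (1 < α → c < hypergeometricThreshold a α β) := by
    rcases hs with ⟨h1, -, h3⟩ | ⟨h1, h2⟩ | ⟨h1, -, h3, h4⟩ | ⟨h1, h2, h3⟩
    · exact ⟨Or.inl h1, fun _ => h3⟩
    · exact ⟨Or.inl h1, fun h => absurd h h2.not_gt⟩
    · exact ⟨Or.inr ⟨h1, h3⟩, fun _ => h4⟩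
    · exact ⟨Or.inr ⟨h1, h3⟩, fun h => absurd h h2.not_gt⟩
  obtain ⟨x, hx, h0⟩ := exists_stieltjesEquationReal_eq_zero ha hb hα hαβ hcond.1 hcond.2
  refine ⟨x, hx, fun z hz => ⟨fun h => ?_, ?_⟩, fun hb' h1 => ?_⟩
  · obtain ⟨y, hy, rfl, hy0⟩ := eq_ofReal_of_hypergeometricLHS_eq_zero ha hb hα hαβ hz h
    rw [(strictAntiOn_stieltjesEquationReal c ha hb hα hαβ).injOn hy hx (hy0.trans h0.symm)]
  · rintro rfl
    rw [hypergeometricLHS_ofReal b c ha hα hαβ hx, h0, Complex.ofReal_zero]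
  · rw [lt_div_iff₀ hb']
    rw [stieltjesEquationReal] at h0
    linarith [rpow_mul_stieltjesTransformReal_lt_threshold ha h1 hαβ hx]
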